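/- **Model.** Let $n\ge 1$. Balls are allocated one after the other into $n$ bins, all of them empty at first. Let $x_i^{(t)}$ be the load of bin $i$ after $t$ balls, and let $\mathrm{Gap}(t)=\max_{1\le i\le n}x_i^{(t)}-t/n$. For each ball, two bins are sampled independently and uniformly at random (with replacement), and the same binary query is sent to both of them; a bin that answers "yes" is called heavy. If exactly one of the two sampled bins is heavy, the ball is placed in the other one. If both bins give the same answer, the ball is placed in one of the two, chosen by an independent fair coin. * In an adaptive $\mathrm{Quantile}(\delta)$ process, before each ball the process chooses a quantile $\delta\in\{1/n,2/n,\dots,1\}$ as a function of the full history so far. The bins are ranked $1,\dots,n$ by decreasing current load, with ties ordered in any way (which may also depend on the history), and a bin is heavy if its rank is at most $\delta n$. * In an adaptive $\mathrm{Threshold}(f)$ process, before each ball the process chooses a threshold $f\in\mathbb R$ (in particular, it may be any natural number) as a function of the full history so far, and a bin is heavy if its current load is at least $f$. **Theorem.** There is a function $\varepsilon:\mathbb N\to\mathbb R$ with $\varepsilon(n)=o(n^{-2})$ as $n\to\infty$ such that for every $n\ge 1$, for $m$ equal to $\tfrac1{10}\,n\sqrt{\log n}$ rounded to an integer (up or down),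 and for every adaptive $\mathrm{Quantile}(\delta)$ process and every adaptive $\mathrm{Threshold}(f)$ process with $n$ bins, $$\Pr\Big[\mathrm{Gap}(m)\ \ge\ \tfrac1{20}\sqrt{\log n}\Big]\ \ge\ 1-\varepsilon(n).$$ -/

import Mathlib

open Filter Asymptotics

namespace OneQuery

/-- The record of one step: the two sampled bins and the bin that received the ball. -/
structure Record (n : ℕ) where
  first : Fin n
  second : Fin n
  dest : Fin n

/-- The full history of the process up to some step, most recent step first. -/
abbrev History (n : ℕ) := List (Record n)

/-- The load of bin `i`: the number of balls that it has received. -/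
def load {n : ℕ} (h : History n) (i : Fin n) : ℕ :=
  (h.map Record.dest).count i

/-- Maximum load minus average load, after the steps recorded in `h`. -/
noncomputable def gap {n : ℕ} (h : History n) : ℝ :=
  ((Finset.univ.sup (load h) : ℕ) : ℝ) - (h.length : ℝ) / (n : ℝ)

/-- The randomness of one step: two bins and a coin for breaking ties. -/
abbrev Sample (n : ℕ) := Fin n × Fin n × Bool

/-- An adaptive query: the answer that each bin gives, where the query is chosen from the history
of the previous steps. The answer `True` means that the bin counts as a heavy one. -/
abbrev Query (n : ℕ) := History n → Fin n → Prop

open Classical in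
/-- Both sampled bins receive the query. If exactly one of them is heavy, then the ball goes to the
other one; if the answers agree, then the tie is broken by the coin. -/
noncomputable def place {n : ℕ} (query : Query n) (h : History n) (s : Sample n) : Fin n :=
  if query h s.1 ∧ ¬ query h s.2.1 then s.2.1
  else if ¬ query h s.1 ∧ query h s.2.1 then s.1
  else if s.2.2 then s.1 else s.2.1

/-- The history after `t` steps, as a function of the randomness of these steps. -/
noncomputable def run {n : ℕ} (query : Query n) : (t : ℕ) → (Fin t → Sample n) → History n
  | 0, _ => []
  | t + 1, ω =>
    let h := run query t (Fin.init ω)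
    let s := ω (Fin.last t)
    ⟨s.1, s.2.1, place query h s⟩ :: h

/-- The probability that the history after `m` steps lies in `E`. The uniform distribution on
`Fin m → Sample n` makes all sampled bins and all coins independent and uniform. -/
noncomputable def prob {n : ℕ} (query : Query n) (m : ℕ) (E : Set (History n)) : ℝ :=
  (ProbabilityTheory.uniformOn (Set.univ : Set (Fin m → Sample n))).real
    {ω | run query m ω ∈ E}

/-- The bijection `r` lists the bins by decreasing load `x`, with ties in any order.
Positions are counted from `0` here, so bin `i` has rank `r i + 1`. -/
def IsRanking {n : ℕ} (x : Fin n → ℕ) (r : Fin n ≃ Fin n) : Prop :=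
  Antitone fun p : Fin n => x (r.symm p)

/-- An adaptive one-query quantile process: the quantile used in the next step, one of
`1/n, 2/n, …, 1`, is a function of the history. Tied bins may be ranked in any way, which may
also depend on the history. -/
structure QuantileProcess (n : ℕ) where
  delta : History n → ℝ
  delta_mem : ∀ h, ∃ k : ℕ, 1 ≤ k ∧ k ≤ n ∧ delta h = (k : ℝ) / (n : ℝ)
  rank : History n → (Fin n ≃ Fin n)
  rank_isRanking : ∀ h, IsRanking (load h) (rank h)

/-- A bin is heavy if its rank is at most `δ n`. -/
def QuantileProcess.query {n : ℕ} (Q : QuantileProcess n) : Query n :=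
  fun h j => (((Q.rank h j : ℕ) + 1 : ℕ) : ℝ) ≤ Q.delta h * (n : ℝ)

/-- An adaptive one-query threshold process: the load threshold used in the next step is a
function of the history. -/
structure ThresholdProcess (n : ℕ) where
  threshold : History n → ℝ

/-- A bin is heavy if its load is at least the threshold. -/
def ThresholdProcess.query {n : ℕ} (T : ThresholdProcess n) : Query n :=
  fun h j => T.threshold h ≤ (load h j : ℝ)

end OneQuery

/-!
The lower bound holds for every adaptive binary query, whatever set of bins it declares heavy; the
quantile and threshold processes are special cases. Write `L = √(log n)`. Since `m / n` is about
`L / 10`, it suffices that some bin reaches a load of about `3 * L / 20`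
(`prob_gap_ge`).

Two facts limit the power of a query. A light bin receives the next ball with probability at least
`1 / n` (`inv_le_hitProb_of_light`). If there are `H` heavy bins, then every bin receives it with
probability at least `H / n ^ 2` (`card_div_sq_le_hitProb`). Call a step large if at least
`exp (-L) * n` bins are heavy. At least half of the steps are large, or at least half are not.

* In `N ≈ m / 2` large steps every bin is hit with probability at least `exp (-L) / n`. A binomial
  counter with this success probability reaches `k ≈ 3 * L / 20` within `N` steps with probability
  at least `n ^ (-1 / 5 - o(1))`, so among `n` bins many should do so.
* In `N` steps that are not large, all but `exp (-L) * n` bins are hit with probability at least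
  `1 / n`. The counter now reaches `k` with probability at least `exp (-3 * L / 5)`, so about
  `exp (-3 * L / 5) * n` bins should reach `k`, far more than the number of about `exp (-L) * N`
  balls of which heavy bins can be deprived.

The query adapts to the history, and the loads of the bins are dependent. Both difficulties are met
by one supermartingale, `potential`: the product over the bins of the probabilities that independent
binomial counters, run for the remaining number of active steps from the current loads, fail to
reach `k`, divided by a power of `1 - θ` that compensates for the heavy bins. It is a
supermartingale (`stepMean_potential_le`) by the inequality `1 - ∑ a i ≤ ∏ (1 - a i)`. It equals `1`
if all the active steps have taken place and no bin has load `k`, so that Markov's inequality bounds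
the probability of this event by the initial value, which is at most `exp (-√n) = o(n ^ (-2))` in
both cases.
-/

namespace OneQuery

/-! ### Expectations over runs -/

open Classical in
/-- The number of steps in the history that were taken while the history so far satisfied
`active`. -/
noncomputable def activeSteps {n : ℕ} (active : History n → Prop) : History n → ℕ
  | [] => 0
  | _ :: h => activeSteps active h + if active h then 1 else 0

/-- The history after one more step with randomness `s`. -/
noncomputable def next {n : ℕ} (query : Query n) (h : History n) (s : Sample n) : History n :=
  ⟨s.1, s.2.1, place query h s⟩ :: h

/-- The expectation of `F` over the uniform randomness of one step. -/
noncomputable def stepMean {n : ℕ} (F : Sample n → ℝ) : ℝ :=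
  (∑ s, F s) / Fintype.card (Sample n)

/-- The expectation of `F` evaluated at the history after `m` steps. -/
noncomputable def runMean {n : ℕ} (query : Query n) (m : ℕ) (F : History n → ℝ) : ℝ :=
  (∑ ω : Fin m → Sample n, F (run query m ω)) / Fintype.card (Fin m → Sample n)

/-- The probability that bin `i` receives the next ball. -/
noncomputable def hitProb {n : ℕ} (query : Query n) (h : History n) (i : Fin n) : ℝ :=
  open Classical in stepMean fun s => if place query h s = i then 1 else 0

theorem run_length {n : ℕ} (query : Query n) (m : ℕ) (ω : Fin m → Sample n) :
    (run query m ω).length = m := by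
  induction m with
  | zero => rfl
  | succ m ih => simp [run, ih]

theorem runMean_succ {n : ℕ} (query : Query n) (m : ℕ) (F : History n → ℝ) :
    runMean query (m + 1) F =
      runMean query m fun h => stepMean fun s => F (next query h s) := by
  have key : ∑ ω : Fin (m + 1) → Sample n, F (run query (m + 1) ω) =
      ∑ ω : Fin m → Sample n, ∑ s, F (next query (run query m ω) s) := by
    rw [← (Fin.snocEquiv fun _ : Fin (m + 1) => Sample n).sum_comp, Fintype.sum_prod_type,
      Finset.sum_comm]
    simp [run, next, Fin.snocEquiv]
  have hcard : (Fintype.card (Fin (m + 1) → Sample n) : ℝ) =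
      Fintype.card (Sample n) * Fintype.card (Fin m → Sample n) := by
    simp only [Fintype.card_pi, Finset.prod_const, Finset.card_univ, Fintype.card_fin]
    push_cast
    ring
  unfold runMean stepMean
  rw [key, hcard, ← Finset.sum_div, div_div]

theorem stepMean_mono {n : ℕ} {F G : Sample n → ℝ} (hFG : ∀ s, F s ≤ G s) :
    stepMean F ≤ stepMean G := by
  unfold stepMean
  gcongr with s
  exact hFG s

theorem stepMean_const {n : ℕ} (hn : 0 < n) (c : ℝ) : stepMean (fun _ : Sample n => c) = c := by
  have : Nonempty (Fin n) := ⟨⟨0, hn⟩⟩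
  have : (Fintype.card (Sample n) : ℝ) ≠ 0 := by exact_mod_cast Fintype.card_ne_zero
  simp only [stepMean, Finset.sum_const, Finset.card_univ, nsmul_eq_mul]
  field_simp

theorem runMean_mono {n : ℕ} (query : Query n) (m : ℕ) {F G : History n → ℝ}
    (hFG : ∀ h, F h ≤ G h) : runMean query m F ≤ runMean query m G := by
  unfold runMean
  gcongr
  exact hFG _

theorem runMean_add {n : ℕ} (query : Query n) (m : ℕ) (F G : History n → ℝ) :
    runMean query m (fun h => F h + G h) = runMean query m F + runMean query m G := by
  simp only [runMean, Finset.sum_add_distrib, add_div]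

theorem runMean_le_of_supermartingale {n : ℕ} (query : Query n) {F : History n → ℝ}
    (hF : ∀ h, stepMean (fun s => F (next query h s)) ≤ F h) (m : ℕ) :
    runMean query m F ≤ F [] := by
  induction m with
  | zero => simp [runMean, run]
  | succ m ih => exact (runMean_succ query m F).trans_le ((runMean_mono query m hF).trans ih)

/-- Markov's inequality: `F` dominates the indicator of the complement of `E`. -/
theorem one_sub_runMean_le_prob {n : ℕ} (hn : 0 < n) (query : Query n) (m : ℕ)
    (E : Set (History n)) {F : History n → ℝ} (hF0 : ∀ h, 0 ≤ F h)
    (hF1 : ∀ h, h.length = m → h ∉ E → 1 ≤ F h) :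
    1 - runMean query m F ≤ prob query m E := by
  classical
  have : Nonempty (Fin n) := ⟨⟨0, hn⟩⟩
  have hcard : (0 : ℝ) < Fintype.card (Fin m → Sample n) := by
    exact_mod_cast Fintype.card_pos
  have hprob : prob query m E =
      (∑ ω : Fin m → Sample n, if run query m ω ∈ E then (1 : ℝ) else 0) /
        Fintype.card (Fin m → Sample n) := by
    rw [prob, MeasureTheory.measureReal_def, ProbabilityTheory.uniformOn_univ, ENNReal.toReal_div,
      MeasureTheory.Measure.count_apply_finite _ (Set.toFinite _)]
    simp
  rw [hprob, runMean, sub_le_iff_le_add, ← add_div, le_div_iff₀ hcard, one_mul,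
    ← Finset.sum_add_distrib]
  calc (Fintype.card (Fin m → Sample n) : ℝ) = ∑ _ω : Fin m → Sample n, (1 : ℝ) := by simp
    _ ≤ _ := by
      refine Finset.sum_le_sum fun ω _ => ?_
      split_ifs with hω
      · linarith [hF0 (run query m ω)]
      · linarith [hF1 _ (run_length query m ω) hω]

/-! ### Loads and hitting probabilities -/

theorem load_nil {n : ℕ} (i : Fin n) : load ([] : History n) i = 0 := rfl

theorem load_next {n : ℕ} (query : Query n) (h : History n) (s : Sample n) (i : Fin n) :
    load (next query h s) i = load h i + if place query h s = i then 1 else 0 := by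
  simp [load, next, List.count_cons]

theorem load_le_load_next {n : ℕ} (query : Query n) (h : History n) (s : Sample n) (i : Fin n) :
    load h i ≤ load (next query h s) i := by
  rw [load_next]
  exact Nat.le_add_right _ _

theorem activeSteps_next {n : ℕ} (active : History n → Prop) [DecidablePred active]
    (query : Query n) (h : History n) (s : Sample n) :
    activeSteps active (next query h s) = activeSteps active h + if active h then 1 else 0 := by
  simp only [next, activeSteps]
  congr

theorem activeSteps_add_activeSteps_not {n : ℕ} (active : History n → Prop) (h : History n) :
    activeSteps active h + activeSteps (fun h => ¬ active h) h = h.length := by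
  induction h with
  | nil => rfl
  | cons a h ih =>
    by_cases ha : active h <;> simp [activeSteps, ha] <;> omega

theorem stepMean_place {n : ℕ} (query : Query n) (h : History n) (f : Fin n → ℝ) :
    stepMean (fun s => f (place query h s)) = ∑ i, hitProb query h i * f i := by
  classical
  simp only [hitProb, stepMean, div_mul_eq_mul_div, ← Finset.sum_div, Finset.sum_mul]
  rw [Finset.sum_comm]
  simp

theorem hitProb_nonneg {n : ℕ} (query : Query n) (h : History n) (i : Fin n) :
    0 ≤ hitProb query h i := by
  unfold hitProb stepMean
  positivity

theorem sum_hitProb {n : ℕ} (hn : 0 < n) (query : Query n) (h : History n) :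
    ∑ i, hitProb query h i = 1 := by
  have := stepMean_place query h fun _ => 1
  rw [stepMean_const hn] at this
  simpa using this.symm

/-- Call the sample selected by the coin the favourite and the other one the alternative. If the
favourite is `i`, then the ball goes there unless `i` is heavy and the alternative is light. Here
`T` is a set of alternatives that do not take the ball away from `i`. -/
theorem card_div_sq_le_hitProb {n : ℕ} (query : Query n) (h : History n) (i : Fin n)
    (T : Finset (Fin n)) (hT : ∀ b ∈ T, query h b ∨ ¬ query h i) :
    (T.card : ℝ) / (n : ℝ) ^ 2 ≤ hitProb query h i := by
  classical
  let e : Fin n × Bool → Sample n := fun x => if x.2 then (i, x.1, true) else (x.1, i, false)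
  have he : Function.Injective e := by
    rintro ⟨a, _ | _⟩ ⟨b, _ | _⟩ hab <;> simp_all [e]
  have hsub : (T ×ˢ (Finset.univ : Finset Bool)).map ⟨e, he⟩ ⊆
      Finset.univ.filter fun s => place query h s = i := by
    intro s hs
    simp only [Finset.mem_map, Finset.mem_product, Finset.mem_univ, and_true,
      Function.Embedding.coeFn_mk] at hs
    obtain ⟨⟨b, c⟩, hb, rfl⟩ := hs
    have := hT b hb
    simp only [Finset.mem_filter, Finset.mem_univ, true_and]
    cases c <;> simp only [e, place] <;> by_cases h1 : query h i <;> by_cases h2 : query h b <;>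
      simp_all
  have hle := Finset.card_le_card hsub
  rw [Finset.card_map, Finset.card_product, Finset.card_univ, Fintype.card_bool] at hle
  have hle' : (T.card : ℝ) * 2 ≤
      ((Finset.univ.filter fun s => place query h s = i).card : ℝ) := by exact_mod_cast hle
  have hcard : (Fintype.card (Sample n) : ℝ) = (n : ℝ) ^ 2 * 2 := by
    simp only [Fintype.card_prod, Fintype.card_fin, Fintype.card_bool]
    push_cast
    ring
  rw [hitProb, stepMean, hcard, Finset.sum_boole,
    ← mul_div_mul_right (T.card : ℝ) ((n : ℝ) ^ 2) two_ne_zero]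
  gcongr

theorem inv_le_hitProb_of_light {n : ℕ} (query : Query n) (h : History n) (i : Fin n)
    (hi : ¬ query h i) : 1 / (n : ℝ) ≤ hitProb query h i := by
  have hn : (n : ℝ) ≠ 0 := by
    have := i.pos
    positivity
  have := card_div_sq_le_hitProb query h i Finset.univ fun _ _ => Or.inr hi
  rw [Finset.card_univ, Fintype.card_fin] at this
  convert this using 1
  field_simp

/-! ### Binomial tails -/

/-- The probability that a counter which starts at `x` and is increased with probability `p` in
each of `r` independent steps reaches `k`. -/
noncomputable def reach (p : ℝ) (k : ℕ) : ℕ → ℕ → ℝ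
  | 0, x => if k ≤ x then 1 else 0
  | r + 1, x => (1 - p) * reach p k r x + p * reach p k r (x + 1)

section

variable {p : ℝ} {k : ℕ}

theorem reach_nonneg (hp0 : 0 ≤ p) (hp1 : p ≤ 1) (r x : ℕ) : 0 ≤ reach p k r x := by
  induction r generalizing x with
  | zero => unfold reach; split_ifs <;> norm_num
  | succ r ih =>
    exact add_nonneg (mul_nonneg (sub_nonneg.2 hp1) (ih x)) (mul_nonneg hp0 (ih (x + 1)))

theorem reach_le_one (hp0 : 0 ≤ p) (hp1 : p ≤ 1) (r x : ℕ) : reach p k r x ≤ 1 := by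
  induction r generalizing x with
  | zero => unfold reach; split_ifs <;> norm_num
  | succ r ih =>
    have := sub_nonneg.2 hp1
    unfold reach
    nlinarith [ih x, ih (x + 1)]

theorem reach_mono (hp0 : 0 ≤ p) (hp1 : p ≤ 1) (r : ℕ) : Monotone (reach p k r) := by
  induction r with
  | zero =>
    intro x y hxy
    unfold reach
    split_ifs <;> first | omega | norm_num
  | succ r ih =>
    intro x y hxy
    have := sub_nonneg.2 hp1
    unfold reach
    gcongr
    · exact ih hxy
    · exact ih (by omega)

theorem reach_eq_one_of_le {x : ℕ} (hx : k ≤ x) (r : ℕ) : reach p k r x = 1 := by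
  induction r generalizing x with
  | zero => simp [reach, hx]
  | succ r ih => rw [reach, ih hx, ih (by omega)]; ring

theorem choose_mul_le_reach (hp0 : 0 ≤ p) (hp1 : p ≤ 1) (r j x : ℕ) (hx : k ≤ x + j) :
    (r.choose j : ℝ) * p ^ j * (1 - p) ^ r ≤ reach p k r x := by
  have hq := sub_nonneg.2 hp1
  have hq1 : 1 - p ≤ 1 := by linarith
  induction r generalizing j x with
  | zero =>
    cases j with
    | zero => simp [reach, show k ≤ x by omega]
    | succ j => simpa using reach_nonneg hp0 hp1 0 x
  | succ r ih =>
    cases j with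
    | zero =>
      rw [reach_eq_one_of_le (by omega)]
      simpa using pow_le_one₀ hq hq1
    | succ j =>
      have h1 := ih (j + 1) x hx
      have h2 := ih j (x + 1) (by omega)
      have h3 : (r.choose j : ℝ) * p ^ j * (1 - p) ^ r * (1 - p) ≤ reach p k r (x + 1) :=
        (mul_le_of_le_one_right (by positivity) hq1).trans h2
      calc ((r + 1).choose (j + 1) : ℝ) * p ^ (j + 1) * (1 - p) ^ (r + 1)
          = (1 - p) * ((r.choose (j + 1) : ℝ) * p ^ (j + 1) * (1 - p) ^ r) +
            p * ((r.choose j : ℝ) * p ^ j * (1 - p) ^ r * (1 - p)) := by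
            rw [Nat.choose_succ_succ]
            push_cast
            ring
        _ ≤ reach p k (r + 1) x := by
            rw [reach]
            gcongr

end

/-! ### The potential -/

theorem one_sub_sum_le_prod_one_sub {ι : Type*} (s : Finset ι) (a : ι → ℝ)
    (h0 : ∀ i, 0 ≤ a i) (h1 : ∀ i, a i ≤ 1) :
    1 - ∑ i ∈ s, a i ≤ ∏ i ∈ s, (1 - a i) := by
  classical
  induction s using Finset.induction_on with
  | empty => simp
  | insert i s hi ih =>
    rw [Finset.sum_insert hi, Finset.prod_insert hi]
    nlinarith [h0 i, h1 i, Finset.sum_nonneg fun j (_ : j ∈ s) => h0 j]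

/-- Dropping the terms of a small set `X` from the sum costs at most the factor `1 - θ`. -/
theorem one_sub_mul_one_sub_sum_compl_le_prod {n : ℕ} (X : Finset (Fin n)) (a : Fin n → ℝ)
    {p θ : ℝ} (hp1 : p ≤ 1) (hX : (X.card : ℝ) * p ≤ θ) (hθ : θ ≤ 1) (h0 : ∀ i, 0 ≤ a i)
    (h1 : ∀ i, a i ≤ p) :
    (1 - θ) * (1 - ∑ i ∈ Xᶜ, a i) ≤ ∏ i, (1 - a i) := by
  have h1' : ∀ i, a i ≤ 1 := fun i => (h1 i).trans hp1
  rw [← Finset.prod_mul_prod_compl X]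
  have hA := one_sub_sum_le_prod_one_sub X a h0 h1'
  have hB := one_sub_sum_le_prod_one_sub Xᶜ a h0 h1'
  have hsum : ∑ i ∈ X, a i ≤ X.card * p := by
    simpa using Finset.sum_le_card_nsmul X a p fun i _ => h1 i
  have hB0 : 0 ≤ ∏ i ∈ Xᶜ, (1 - a i) :=
    Finset.prod_nonneg fun i _ => sub_nonneg.2 (h1' i)
  calc (1 - θ) * (1 - ∑ i ∈ Xᶜ, a i) ≤ (1 - θ) * ∏ i ∈ Xᶜ, (1 - a i) :=
        mul_le_mul_of_nonneg_left hB (by linarith)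
    _ ≤ _ := mul_le_mul_of_nonneg_right (by linarith) hB0

/-- Here `N - activeSteps active h` is the number `r` of active steps that remain to be counted.
If in these steps the loads grew as independent binomial counters with success probability `p`,
then the product would be the conditional probability that no bin reaches load `k`. The factor in
front pays for the bins that may have a smaller success probability: they are to make up a total
probability of at most `θ` in each active step. -/
noncomputable def potential {n : ℕ} (p θ : ℝ) (k N : ℕ) (active : History n → Prop)
    (h : History n) : ℝ :=
  ((1 - θ) ^ (N - activeSteps active h))⁻¹ *
    ∏ i, (1 - reach p k (N - activeSteps active h) (load h i))

section

variable {n : ℕ} {p θ : ℝ} {k N : ℕ} {active : History n → Prop}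

theorem potential_nonneg (hp0 : 0 ≤ p) (hp1 : p ≤ 1) (hθ : θ < 1) (h : History n) :
    0 ≤ potential p θ k N active h := by
  have : 0 ≤ 1 - θ := by linarith
  refine mul_nonneg (by positivity) (Finset.prod_nonneg fun i _ => ?_)
  exact sub_nonneg.2 (reach_le_one hp0 hp1 _ _)

theorem potential_eq_one {h : History n} (hN : N ≤ activeSteps active h)
    (hk : ∀ i, load h i < k) : potential p θ k N active h = 1 := by
  have hr : N - activeSteps active h = 0 := by omega
  simp [potential, hr, reach, fun i => not_le.2 (hk i)]

theorem prod_one_sub_reach_load_next (query : Query n) (h : History n) (s : Sample n) (r : ℕ)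
    (b : Fin n → ℝ)
    (hb : ∀ i, 1 - reach p k r (load h i + 1) = (1 - reach p k r (load h i)) * (1 - b i)) :
    ∏ i, (1 - reach p k r (load (next query h s) i)) =
      (∏ i, (1 - reach p k r (load h i))) * (1 - b (place query h s)) := by
  classical
  calc ∏ i, (1 - reach p k r (load (next query h s) i))
      = ∏ i, ((1 - reach p k r (load h i)) * if place query h s = i then 1 - b i else 1) := by
        refine Finset.prod_congr rfl fun i _ => ?_
        rw [load_next]
        split_ifs
        · exact hb i
        · simp
    _ = _ := by
        rw [Finset.prod_mul_distrib]
        simp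

/-- The potential is a supermartingale if, in each active step, all bins outside a small
exceptional set `X h` receive the ball with probability at least `p`. The ball goes to one bin only,
but by `one_sub_mul_one_sub_sum_compl_le_prod` this is no worse than independent counters. -/
theorem stepMean_potential_le (hn : 0 < n) (query : Query n) (hp0 : 0 ≤ p) (hp1 : p ≤ 1)
    (hθ : θ < 1) (X : History n → Finset (Fin n))
    (hX : ∀ h, active h → ((X h).card : ℝ) * p ≤ θ)
    (hhit : ∀ h, active h → ∀ i ∉ X h, p ≤ hitProb query h i) (h : History n) :
    stepMean (fun s => potential p θ k N active (next query h s)) ≤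
      potential p θ k N active h := by
  classical
  have hq : 0 < 1 - θ := by linarith
  by_cases hr : active h ∧ activeSteps active h < N
  · obtain ⟨hact, hlt⟩ := hr
    obtain ⟨r, hr⟩ : ∃ r, N - activeSteps active h = r + 1 :=
      ⟨N - activeSteps active h - 1, by omega⟩
    have hr' : N - (activeSteps active h + 1) = r := by omega
    have hA : ∀ i, 0 ≤ 1 - reach p k r (load h i) :=
      fun i => sub_nonneg.2 (reach_le_one hp0 hp1 _ _)
    -- `b i` is the relative decrease of the factor of bin `i` when this bin receives the ball.
    have hb : ∀ i, ∃ b : ℝ, 0 ≤ b ∧ b ≤ 1 ∧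
        1 - reach p k r (load h i + 1) = (1 - reach p k r (load h i)) * (1 - b) := by
      intro i
      have hmono : reach p k r (load h i) ≤ reach p k r (load h i + 1) :=
        reach_mono hp0 hp1 r (Nat.le_succ _)
      have hle : reach p k r (load h i + 1) ≤ 1 := reach_le_one hp0 hp1 _ _
      rcases (hA i).eq_or_lt with hz | hpos
      · exact ⟨0, le_rfl, zero_le_one, by linarith⟩
      · refine ⟨1 - (1 - reach p k r (load h i + 1)) / (1 - reach p k r (load h i)), ?_, ?_, ?_⟩
        · rw [sub_nonneg, div_le_one hpos]
          linarith
        · have : 0 ≤ (1 - reach p k r (load h i + 1)) / (1 - reach p k r (load h i)) :=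
            div_nonneg (by linarith) hpos.le
          linarith
        · field_simp
          ring
    choose b hb0 hb1 hb using hb
    set A := ∏ i, (1 - reach p k r (load h i)) with hAdef
    have hA0 : 0 ≤ A := Finset.prod_nonneg fun i _ => hA i
    have hnext : ∀ s, potential p θ k N active (next query h s) =
        ((1 - θ) ^ r)⁻¹ * A * (1 - b (place query h s)) := by
      intro s
      rw [potential, activeSteps_next, if_pos hact, hr', prod_one_sub_reach_load_next _ _ _ _ b hb,
        mul_assoc]
    have hcur : potential p θ k N active h =
        ((1 - θ) ^ (r + 1))⁻¹ * A * ∏ i, (1 - p * b i) := by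
      rw [potential, hr, mul_assoc, hAdef, ← Finset.prod_mul_distrib]
      congr 1
      refine Finset.prod_congr rfl fun i _ => ?_
      rw [reach]
      linear_combination p * hb i
    -- After dividing by `A`, this bounds the expected potential after the step.
    have hsum : ∑ i, hitProb query h i * (1 - b i) ≤ 1 - ∑ i ∈ (X h)ᶜ, p * b i := by
      have h1 : ∑ i ∈ (X h)ᶜ, p * b i ≤ ∑ i, hitProb query h i * b i :=
        calc ∑ i ∈ (X h)ᶜ, p * b i ≤ ∑ i ∈ (X h)ᶜ, hitProb query h i * b i := by
              refine Finset.sum_le_sum fun i hi => ?_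
              exact mul_le_mul_of_nonneg_right
                (hhit h hact i (Finset.mem_compl.1 hi)) (hb0 i)
          _ ≤ _ := Finset.sum_le_sum_of_subset_of_nonneg (Finset.subset_univ _)
              fun i _ _ => mul_nonneg (hitProb_nonneg _ _ _) (hb0 i)
      simp only [mul_sub, mul_one, Finset.sum_sub_distrib, sum_hitProb hn]
      linarith
    have hprod := one_sub_mul_one_sub_sum_compl_le_prod (X h) (fun i => p * b i) hp1 (hX h hact)
      hθ.le (fun i => mul_nonneg hp0 (hb0 i)) (fun i => mul_le_of_le_one_right hp0 (hb1 i))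
    simp only [hnext]
    rw [stepMean_place query h fun i => ((1 - θ) ^ r)⁻¹ * A * (1 - b i), hcur]
    calc ∑ i, hitProb query h i * (((1 - θ) ^ r)⁻¹ * A * (1 - b i))
        = ((1 - θ) ^ r)⁻¹ * A * ∑ i, hitProb query h i * (1 - b i) := by
          rw [Finset.mul_sum]
          exact Finset.sum_congr rfl fun i _ => by ring
      _ ≤ ((1 - θ) ^ r)⁻¹ * A * (1 - ∑ i ∈ (X h)ᶜ, p * b i) := by gcongr
      _ = ((1 - θ) ^ (r + 1))⁻¹ * A * ((1 - θ) * (1 - ∑ i ∈ (X h)ᶜ, p * b i)) := by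
          field_simp
          ring
      _ ≤ _ := by gcongr
  · -- The number of remaining active steps does not change, and loads never decrease.
    have hr' : ∀ s, N - activeSteps active (next query h s) = N - activeSteps active h := by
      intro s
      rw [activeSteps_next]
      split_ifs with hact
      · have : ¬ activeSteps active h < N := fun hlt => hr ⟨hact, hlt⟩
        omega
      · rfl
    calc stepMean (fun s => potential p θ k N active (next query h s))
        ≤ stepMean (fun _ : Sample n => potential p θ k N active h) := by
          refine stepMean_mono fun s => ?_
          rw [potential, potential, hr']
          refine mul_le_mul_of_nonneg_left ?_ (by positivity)
          refine Finset.prod_le_prod (fun i _ => sub_nonneg.2 (reach_le_one hp0 hp1 _ _))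
            fun i _ => ?_
          exact sub_le_sub_left (reach_mono hp0 hp1 _ (load_le_load_next query h s i)) 1
      _ = _ := stepMean_const hn _

theorem runMean_potential_le (hn : 0 < n) (query : Query n) (hp0 : 0 ≤ p) (hp1 : p ≤ 1)
    (hθ : θ < 1) (X : History n → Finset (Fin n))
    (hX : ∀ h, active h → ((X h).card : ℝ) * p ≤ θ)
    (hhit : ∀ h, active h → ∀ i ∉ X h, p ≤ hitProb query h i) (m : ℕ) :
    runMean query m (potential p θ k N active) ≤
      ((1 - θ) ^ N)⁻¹ * (1 - reach p k N 0) ^ n := by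
  refine (runMean_le_of_supermartingale query
    (stepMean_potential_le hn query hp0 hp1 hθ X hX hhit) m).trans_eq ?_
  simp [potential, activeSteps, load_nil]

end

/-- One of the two kinds of steps, those with at least `β * n` heavy bins and the others, makes up
at least half of the run. The first term bounds the failure probability if it is the first kind,
where every bin is hit with probability at least `β / n`; the second term if it is the second kind,
where every light bin is hit with probability at least `1 / n`. -/
theorem prob_exists_load_ge {n : ℕ} (hn : 0 < n) (query : Query n) {β : ℝ} (hβ0 : 0 ≤ β)
    (hβ1 : β < 1) (k N m : ℕ) (hNm : 2 * N ≤ m) :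
    1 - ((1 - reach (β / n) k N 0) ^ n +
        ((1 - β) ^ N)⁻¹ * (1 - reach (1 / n) k N 0) ^ n) ≤
      prob query m {h | ∃ i, k ≤ load h i} := by
  classical
  have hn1 : (1 : ℝ) ≤ n := by exact_mod_cast hn
  have hn0 : (0 : ℝ) < n := by linarith
  let heavy : History n → Finset (Fin n) := fun h => Finset.univ.filter (query h)
  let large : History n → Prop := fun h => β * n ≤ (heavy h).card
  have hpA0 : 0 ≤ β / n := by positivity
  have hpA1 : β / n ≤ 1 := by
    rw [div_le_one hn0]
    linarith
  have hpB0 : 0 ≤ 1 / (n : ℝ) := by positivity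
  have hpB1 : 1 / (n : ℝ) ≤ 1 := by
    rw [div_le_one hn0]
    exact hn1
  have hA : runMean query m (potential (β / n) 0 k N large) ≤
      (1 - reach (β / n) k N 0) ^ n := by
    have := runMean_potential_le (k := k) (N := N) hn query hpA0 hpA1 zero_lt_one
      (active := large) (fun _ => ∅) (by simp) (fun h hh i _ => ?_) m
    · simpa using this
    · refine le_trans ?_ (card_div_sq_le_hitProb query h i (heavy h) fun b hb =>
        Or.inl (Finset.mem_filter.1 hb).2)
      rw [le_div_iff₀ (by positivity)]
      calc β / n * (n : ℝ) ^ 2 = β * n := by field_simp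
        _ ≤ _ := hh
  have hB : runMean query m (potential (1 / n) β k N fun h => ¬ large h) ≤
      ((1 - β) ^ N)⁻¹ * (1 - reach (1 / n) k N 0) ^ n := by
    refine runMean_potential_le hn query hpB0 hpB1 hβ1 heavy (fun h hh => ?_)
      (fun h _ i hi => ?_) m
    · rw [mul_one_div, div_le_iff₀ hn0]
      exact (not_le.1 hh).le
    · exact inv_le_hitProb_of_light query h i (by simpa [heavy] using hi)
  have hA0 := fun h => potential_nonneg (k := k) (N := N) (active := large) hpA0 hpA1 zero_lt_one h
  have hB0 := fun h => potential_nonneg (k := k) (N := N) (active := fun h => ¬ large h)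
    hpB0 hpB1 hβ1 h
  have hmain := one_sub_runMean_le_prob hn query m {h | ∃ i, k ≤ load h i}
    (F := fun h => potential (β / n) 0 k N large h +
      potential (1 / n) β k N (fun h => ¬ large h) h)
    (fun h => add_nonneg (hA0 h) (hB0 h)) (fun h hlen hE => ?_)
  · rw [runMean_add] at hmain
    linarith
  · have hk : ∀ i, load h i < k := by simpa using hE
    have hcount := activeSteps_add_activeSteps_not large h
    rcases le_or_gt N (activeSteps large h) with hc | hc
    · rw [potential_eq_one hc hk]
      linarith [hB0 h]
    · rw [potential_eq_one (N := N) (active := fun h => ¬ large h) (by omega) hk]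
      linarith [hA0 h]

/-! ### Estimates for large `n` -/

theorem exp_neg_two_mul_le_one_sub {x : ℝ} (hx0 : 0 ≤ x) (hx : x ≤ 1 / 2) :
    Real.exp (-(2 * x)) ≤ 1 - x := by
  have h1 : 1 + 2 * x ≤ Real.exp (2 * x) := by linarith [Real.add_one_le_exp (2 * x)]
  rw [Real.exp_neg, inv_le_iff_one_le_mul₀ (Real.exp_pos _)]
  nlinarith

theorem one_sub_pow_le_exp_neg_mul {x : ℝ} (hx : x ≤ 1) (n : ℕ) :
    (1 - x) ^ n ≤ Real.exp (-(n * x)) := by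
  calc (1 - x) ^ n ≤ Real.exp (-x) ^ n := by
        have := sub_nonneg.2 hx
        gcongr
        exact Real.one_sub_le_exp_neg x
    _ = Real.exp (-(n * x)) := by
        rw [← Real.exp_nat_mul]
        ring_nf

theorem pow_mul_le_reach {p : ℝ} (hp0 : 0 ≤ p) (hp1 : p ≤ 1) {k N : ℕ} (hk : 0 < k) {γ : ℝ}
    (hγ0 : 0 ≤ γ) (hγ : γ * k ≤ p * (N + 1 - k)) :
    γ ^ k * (1 - p) ^ N ≤ reach p k N 0 := by
  refine le_trans ?_ (choose_mul_le_reach hp0 hp1 N k 0 (by omega))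
  have hq := sub_nonneg.2 hp1
  refine mul_le_mul_of_nonneg_right ?_ (by positivity)
  have hk0 : (0 : ℝ) < k := by exact_mod_cast hk
  have hcast : (N : ℝ) + 1 - k ≤ ((N + 1 - k : ℕ) : ℝ) := by
    have : N + 1 ≤ (N + 1 - k) + k := by omega
    rw [sub_le_iff_le_add]
    exact_mod_cast this
  have hfact : (k.factorial : ℝ) ≤ (k : ℝ) ^ k := by exact_mod_cast Nat.factorial_le_pow k
  calc γ ^ k ≤ (p * ((N + 1 - k : ℕ) : ℝ) / k) ^ k := by
        gcongr
        rw [le_div_iff₀ hk0]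
        exact hγ.trans (mul_le_mul_of_nonneg_left hcast hp0)
    _ = ((N + 1 - k : ℕ) : ℝ) ^ k / (k : ℝ) ^ k * p ^ k := by
        rw [div_pow, mul_pow]
        ring
    _ ≤ ((N + 1 - k : ℕ) : ℝ) ^ k / (k.factorial : ℝ) * p ^ k := by gcongr
    _ ≤ (N.choose k : ℝ) * p ^ k := by
        gcongr
        exact Nat.pow_le_choose k N

section

variable {n k N m : ℕ} {L : ℝ}

theorem twelve_le_of_exp_sq (hL : 40 ≤ L) (hn : (n : ℝ) = Real.exp (L ^ 2)) : (12 : ℝ) ≤ n := by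
  rw [hn]
  nlinarith [Real.add_one_le_exp (L ^ 2)]

/-- A bin that is hit with probability `exp (-α) / n` in each of `N` steps is hit `k` times with
probability at least `exp (-(α + 2) * (L / 5) - L / 5)`: since `k` is at most six times
`(N + 1 - k) / n` and `1 / 6 ≥ exp (-2)`, each of the `k ≤ L / 5` hits costs a factor
`exp (-(α + 2))`, and the factor `exp (-(L / 5))` accounts for the other steps. -/
theorem exp_mul_le_reach (hL : 40 ≤ L) (hn : (n : ℝ) = Real.exp (L ^ 2)) (hk0 : 0 < k)
    (hk : (k : ℝ) ≤ L / 5) (hN0 : n * L / 20 - 1 ≤ (N : ℝ)) (hN1 : (N : ℝ) ≤ n * L / 10)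
    {α : ℝ} (hα : 0 ≤ α) :
    Real.exp (-(α + 2) * (L / 5) - L / 5) ≤ reach (Real.exp (-α) / n) k N 0 := by
  have hα1 : Real.exp (-α) ≤ 1 := Real.exp_le_one_iff.2 (by linarith)
  have hn12 := twelve_le_of_exp_sq hL hn
  have hn0 : (0 : ℝ) < n := by linarith
  set p := Real.exp (-α) / n with hp
  have hp0 : 0 ≤ p := by positivity
  have hpn : p ≤ 1 / n := by
    rw [hp]
    gcongr
  have hn2 : 1 / (n : ℝ) ≤ 1 / 2 := by
    gcongr
    linarith
  have hp1 : p ≤ 1 := by linarith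
  have h6 : Real.exp (-2) ≤ 1 / 6 := by
    have h2 : Real.exp 2 = Real.exp 1 * Real.exp 1 := by
      rw [← Real.exp_add]
      norm_num
    rw [Real.exp_neg, ← one_div]
    gcongr
    rw [h2]
    nlinarith [Real.exp_one_gt_d9]
  have hbase : Real.exp (-(α + 2)) * k ≤ p * (N + 1 - k) := by
    have hexp : Real.exp (-(α + 2)) = Real.exp (-α) * Real.exp (-2) := by
      rw [← Real.exp_add]
      ring_nf
    have hkn : Real.exp (-2) * k ≤ (N + 1 - k) / n := by
      rw [le_div_iff₀ hn0]
      calc Real.exp (-2) * k * n ≤ 1 / 6 * k * n := by gcongr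
        _ ≤ _ := by nlinarith
    calc Real.exp (-(α + 2)) * k = Real.exp (-α) * (Real.exp (-2) * k) := by rw [hexp, mul_assoc]
      _ ≤ Real.exp (-α) * ((N + 1 - k) / n) := by gcongr
      _ = p * (N + 1 - k) := by
          rw [hp]
          ring
  refine le_trans ?_ (pow_mul_le_reach hp0 hp1 hk0 (Real.exp_pos _).le hbase)
  rw [sub_eq_add_neg, Real.exp_add]
  refine mul_le_mul ?_ ?_ (Real.exp_pos _).le (by positivity)
  · rw [← Real.exp_nat_mul, Real.exp_le_exp]
    nlinarith
  · calc Real.exp (-(L / 5)) ≤ Real.exp (-(2 * (1 / n))) ^ N := by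
          rw [← Real.exp_nat_mul, Real.exp_le_exp]
          have : (N : ℝ) / n ≤ L / 10 := by
            rw [div_le_iff₀ hn0]
            linarith
          have h2 : (N : ℝ) * -(2 * (1 / n)) = -(2 * (N / n)) := by ring
          linarith
      _ ≤ (1 - p) ^ N := by
          gcongr
          exact (exp_neg_two_mul_le_one_sub (by positivity) hn2).trans (by linarith)

/-- Steps with at least `exp (-L) * n` heavy bins: the expected number of bins that reach load
`k` is `n ^ (4 / 5 - o(1))`. -/
theorem one_sub_reach_pow_le_of_large (hL : 40 ≤ L) (hn : (n : ℝ) = Real.exp (L ^ 2))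
    (hk0 : 0 < k) (hk : (k : ℝ) ≤ L / 5) (hN0 : n * L / 20 - 1 ≤ (N : ℝ))
    (hN1 : (N : ℝ) ≤ n * L / 10) :
    (1 - reach (Real.exp (-L) / n) k N 0) ^ n ≤ Real.exp (-Real.exp (L ^ 2 / 2)) := by
  have hn12 := twelve_le_of_exp_sq hL hn
  have hn0 : (0 : ℝ) < n := by linarith
  have hexp1 : Real.exp (-L) ≤ 1 := Real.exp_le_one_iff.2 (by linarith)
  have hlow := exp_mul_le_reach hL hn hk0 hk hN0 hN1 (α := L) (by linarith)
  have hp1 : Real.exp (-L) / n ≤ 1 := by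
    rw [div_le_one hn0]
    linarith
  refine (one_sub_pow_le_exp_neg_mul (reach_le_one (by positivity) hp1 _ _) n).trans ?_
  rw [Real.exp_le_exp, neg_le_neg_iff]
  calc Real.exp (L ^ 2 / 2) ≤ Real.exp (L ^ 2 + (-(L + 2) * (L / 5) - L / 5)) := by
        rw [Real.exp_le_exp]
        nlinarith
    _ = n * Real.exp (-(L + 2) * (L / 5) - L / 5) := by rw [Real.exp_add, hn]
    _ ≤ _ := by gcongr

/-- Steps with fewer than `exp (-L) * n` heavy bins: the expected number of bins that reach load
`k` is `exp (-O(L)) * n`, with a smaller constant than in the price `exp (-L) * N` of the heavy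
bins. -/
theorem inv_mul_one_sub_reach_pow_le_of_small (hL : 40 ≤ L) (hn : (n : ℝ) = Real.exp (L ^ 2))
    (hk0 : 0 < k) (hk : (k : ℝ) ≤ L / 5) (hN0 : n * L / 20 - 1 ≤ (N : ℝ))
    (hN1 : (N : ℝ) ≤ n * L / 10) :
    ((1 - Real.exp (-L)) ^ N)⁻¹ * (1 - reach (1 / n) k N 0) ^ n ≤
      Real.exp (-Real.exp (L ^ 2 / 2)) := by
  have hn12 := twelve_le_of_exp_sq hL hn
  have hn0 : (0 : ℝ) < n := by linarith
  have hlow := exp_mul_le_reach hL hn hk0 hk hN0 hN1 (α := 0) le_rfl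
  rw [neg_zero, Real.exp_zero] at hlow
  have hp1 : 1 / (n : ℝ) ≤ 1 := by
    rw [div_le_one hn0]
    linarith
  have hβ : Real.exp (-L) ≤ 1 / 2 := by
    rw [Real.exp_neg, ← one_div]
    gcongr
    linarith [Real.add_one_le_exp L]
  have hfac : ((1 - Real.exp (-L)) ^ N)⁻¹ ≤ Real.exp (N * (2 * Real.exp (-L))) := by
    rw [← inv_inv (Real.exp (N * (2 * Real.exp (-L)))), ← Real.exp_neg, ← mul_neg,
      Real.exp_nat_mul]
    gcongr
    exact exp_neg_two_mul_le_one_sub (Real.exp_pos _).le hβ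
  have hpow := one_sub_pow_le_exp_neg_mul
    (reach_le_one (k := k) (by positivity) hp1 N 0) n
  refine (mul_le_mul hfac hpow (pow_nonneg (sub_nonneg.2
    (reach_le_one (by positivity) hp1 _ _)) _) (Real.exp_pos _).le).trans ?_
  rw [← Real.exp_add, Real.exp_le_exp]
  have hloss : N * (2 * Real.exp (-L)) ≤ n * (Real.exp (-(3 * L / 5)) / 2) := by
    have h1 : 2 * L / 5 ≤ Real.exp (2 * L / 5) := by linarith [Real.add_one_le_exp (2 * L / 5)]
    have h2 : Real.exp (-(3 * L / 5)) = Real.exp (2 * L / 5) * Real.exp (-L) := by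
      rw [← Real.exp_add]
      ring_nf
    calc N * (2 * Real.exp (-L)) ≤ n * L / 10 * (2 * Real.exp (-L)) := by gcongr
      _ = n * (2 * L / 5 * Real.exp (-L) / 2) := by ring
      _ ≤ _ := by
          rw [h2]
          gcongr
  have hgain : Real.exp (L ^ 2 / 2) ≤ n * (Real.exp (-(3 * L / 5)) / 2) := by
    have h1 : (2 : ℝ) ≤ Real.exp (L ^ 2 / 2 - 3 * L / 5) := by
      nlinarith [Real.add_one_le_exp (L ^ 2 / 2 - 3 * L / 5)]
    have h2 : n * Real.exp (-(3 * L / 5)) =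
        Real.exp (L ^ 2 / 2) * Real.exp (L ^ 2 / 2 - 3 * L / 5) := by
      rw [hn, ← Real.exp_add, ← Real.exp_add]
      ring_nf
    nlinarith [Real.exp_pos (L ^ 2 / 2)]
  have hlow' : n * Real.exp (-(3 * L / 5)) ≤ n * reach (1 / n) k N 0 := by
    refine mul_le_mul_of_nonneg_left (le_trans (le_of_eq ?_) hlow) hn0.le
    ring_nf
  linarith

theorem le_gap_of_le_load {h : History n} {c : ℝ} {i : Fin n}
    (hi : c + h.length / (n : ℝ) ≤ load h i) : c ≤ gap h := by
  have : (load h i : ℝ) ≤ ((Finset.univ.sup (load h) : ℕ) : ℝ) := by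
    exact_mod_cast Finset.le_sup (f := load h) (Finset.mem_univ i)
  unfold gap
  linarith

theorem prob_mono_of_length (query : Query n) {E F : Set (History n)}
    (hEF : ∀ h, h.length = m → h ∈ E → h ∈ F) : prob query m E ≤ prob query m F := by
  refine MeasureTheory.measureReal_mono (fun ω hω => hEF _ (run_length query m ω) hω) ?_
  exact ne_top_of_le_ne_top ENNReal.one_ne_top MeasureTheory.prob_le_one

/-- The gap bound for an arbitrary adaptive query and large `n`. -/
theorem prob_gap_ge (hL : 40 ≤ Real.sqrt (Real.log n))
    (hm : |(m : ℝ) - (1 / 10) * (n : ℝ) * Real.sqrt (Real.log n)| < 1) (query : Query n) :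
    1 - 2 * Real.exp (-Real.sqrt n) ≤
      prob query m {h | (1 / 20) * Real.sqrt (Real.log n) ≤ gap h} := by
  set L := Real.sqrt (Real.log n) with hLdef
  have hlog : 0 < Real.log n := Real.sqrt_pos.1 (by linarith)
  have hnpos : 0 < n := by
    rcases Nat.eq_zero_or_pos n with rfl | h
    · simp at hlog
    · exact h
  have hn0 : (0 : ℝ) < n := by exact_mod_cast hnpos
  have hn : (n : ℝ) = Real.exp (L ^ 2) := by
    rw [Real.sq_sqrt hlog.le, Real.exp_log hn0]
  have hn12 := twelve_le_of_exp_sq hL hn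
  have hsqrt : Real.sqrt n = Real.exp (L ^ 2 / 2) := by rw [hn, Real.exp_half]
  obtain ⟨hm1, hm2⟩ := abs_lt.1 hm
  obtain ⟨N, hN⟩ : ∃ N, N = m / 2 := ⟨_, rfl⟩
  have hNm : 2 * (N : ℝ) ≤ m := by
    have : 2 * N ≤ m := by omega
    exact_mod_cast this
  have hNm' : (m : ℝ) ≤ 2 * N + 1 := by
    have : m ≤ 2 * N + 1 := by omega
    exact_mod_cast this
  -- The summand `1` absorbs the rounding of `m`.
  set k := ⌈3 * L / 20⌉₊ + 1 with hk
  have hk1 : 3 * L / 20 + 1 ≤ (k : ℝ) := by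
    rw [hk]
    push_cast
    linarith [Nat.le_ceil (3 * L / 20)]
  have hk2 : (k : ℝ) ≤ L / 5 := by
    rw [hk]
    push_cast
    linarith [Nat.ceil_lt_add_one (show 0 ≤ 3 * L / 20 by linarith)]
  have hN0 : n * L / 20 - 1 ≤ (N : ℝ) := by linarith
  have hN1 : (N : ℝ) ≤ n * L / 10 := by nlinarith
  have hA := one_sub_reach_pow_le_of_large hL hn (Nat.succ_pos _) hk2 hN0 hN1
  have hB := inv_mul_one_sub_reach_pow_le_of_small hL hn (Nat.succ_pos _) hk2 hN0 hN1
  have hmain := prob_exists_load_ge hnpos query (Real.exp_pos (-L)).le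
    (Real.exp_lt_one_iff.2 (by linarith)) k N m (by omega)
  rw [← hsqrt] at hA hB
  refine le_trans (by linarith) (hmain.trans (prob_mono_of_length query ?_))
  rintro h hlen ⟨i, hi⟩
  refine le_gap_of_le_load (i := i) ?_
  have hi' : (k : ℝ) ≤ load h i := by exact_mod_cast hi
  have hmn : (m : ℝ) / n ≤ L / 10 + 1 := by
    rw [div_le_iff₀ hn0]
    nlinarith
  rw [hlen]
  linarith

end

theorem exp_neg_sqrt_isLittleO :
    (fun n : ℕ => 2 * Real.exp (-Real.sqrt n)) =o[atTop] fun n : ℕ => 1 / (n : ℝ) ^ 2 := by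
  have h := (isLittleO_exp_neg_mul_rpow_atTop one_pos (-4)).comp_tendsto
    (Real.tendsto_sqrt_atTop.comp tendsto_natCast_atTop_atTop)
  refine (h.const_mul_left 2).congr (fun n => by simp) fun n => ?_
  have h4 : Real.sqrt n ^ 4 = (n : ℝ) ^ 2 := by
    rw [show 4 = 2 * 2 by norm_num, pow_mul, Real.sq_sqrt (Nat.cast_nonneg n)]
  simp only [Function.comp_apply]
  rw [Real.rpow_neg (Real.sqrt_nonneg _), ← h4, one_div]
  norm_cast

end OneQuery

theorem mainTheorem2 :
    ∃ ε : ℕ → ℝ, ε =o[atTop] (fun n : ℕ => 1 / (n : ℝ) ^ 2) ∧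
      ∀ n : ℕ, 1 ≤ n →
        ∀ m : ℕ, |(m : ℝ) - (1 / 10) * (n : ℝ) * Real.sqrt (Real.log n)| < 1 →
          (∀ Q : OneQuery.QuantileProcess n,
            1 - ε n ≤ OneQuery.prob Q.query m
              {h | (1 / 20) * Real.sqrt (Real.log n) ≤ OneQuery.gap h}) ∧
          (∀ T : OneQuery.ThresholdProcess n,
            1 - ε n ≤ OneQuery.prob T.query m
              {h | (1 / 20) * Real.sqrt (Real.log n) ≤ OneQuery.gap h}) := by
  -- For small `n` the bound is trivial, with error probability `1`.
  refine ⟨fun n => if 40 ≤ Real.sqrt (Real.log n) then 2 * Real.exp (-Real.sqrt n) else 1,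
    ?_, fun n _ m hm => ?_⟩
  · refine OneQuery.exp_neg_sqrt_isLittleO.congr' ?_ EventuallyEq.rfl
    have htend : Tendsto (fun n : ℕ => Real.sqrt (Real.log n)) atTop atTop :=
      Real.tendsto_sqrt_atTop.comp (Real.tendsto_log_atTop.comp tendsto_natCast_atTop_atTop)
    filter_upwards [htend.eventually_ge_atTop 40] with n hn
    rw [if_pos hn]
  · have key : ∀ query : OneQuery.Query n,
        1 - (if 40 ≤ Real.sqrt (Real.log n) then 2 * Real.exp (-Real.sqrt n) else 1) ≤
          OneQuery.prob query m {h | (1 / 20) * Real.sqrt (Real.log n) ≤ OneQuery.gap h} := by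
      intro query
      split_ifs with hL
      · exact OneQuery.prob_gap_ge hL hm query
      · rw [sub_self]
        exact MeasureTheory.measureReal_nonneg
    exact ⟨fun Q => key Q.query, fun T => key T.query⟩
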